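/- **Setting.** Let $\mathbb S$ be a cancellative monoid (not necessarily commutative, written additively, neutral element $0$) which is totally ordered by left divisibility: $s\le t$ iff $t=s+p$ for some $p\in\mathbb S$; this unique $p$ is denoted $t-s$. Let $(\mathcal C,\boxtimes,E)$ be a tensor (monoidal) category whose unit object $E$ is initial, with unique morphisms $1_A:E\to A$, in which all inductive systems (indexed by directed sets) have inductive limits, and such that the functor $\boxtimes:\mathcal C\times\mathcal C\to\mathcal C$ preserves inductive limits. Associativity and unit constraints are suppressed in the notation. The inclusions are $\iota^1_{A,B}=\mathrm{id}_A\boxtimes 1_B:A\to A\boxtimes B$ and $\iota^2_{A,B}=1_A\boxtimes\mathrm{id}_B:B\to A\boxtimes B$, and similarly $\iota^{i;n}:B_i\to B_1\boxtimes\dots\boxtimes B_n$. Morphisms $f_i:B_i\to A$ $(1\le i\le n)$ are *independent* if there is a morphism $h:B_1\boxtimes\dots\boxtimes B_n\to A$ with $h\circ\iota^{i;n}=f_i$ for all $i$; such an $h$ is an *independence morphism*. A *comonoidal system* $(A_t)_{t\in\mathbb S}$ in $\mathcal C$ is a family of objects with coassociative coproduct morphisms $\Delta_{s,t}:A_{s+t}\to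 A_s\boxtimes A_t$ and a counit morphism $\delta:A_0\to E$ satisfying the counit identities; it is *full* if all $\Delta_{s,t}$ and $\delta$ are isomorphisms. A *categorical Lévy process* on $(A_t)$ is a family of morphisms $j_{s,t}:A_{t-s}\to B$ $(s\le t)$ to a common object $B$ such that 1. $j_{t,t}=1_B\circ\delta$ for all $t$; 2. $j_{s_1,t_1},\dots,j_{s_n,t_n}$ are independent whenever $s_1\le t_1\le s_2\le\dots\le s_n\le t_n$; 3. for all $r\le s\le t$ there is an independence morphism $j_{r,s,t}:A_{s-r}\boxtimes A_{t-s}\to B$ of $j_{r,s}$ and $j_{s,t}$ with $j_{r,s,t}\circ\Delta_{s-r,t-s}=j_{r,t}$. **Construction.** Let $(A_t)_{t\in\mathbb S}$ be a comonoidal system in $\mathcal C$. For $t\in\mathbb S$ let $\mathbb F_t$ be the set of factorizations of $t$, i.e. of tuples $\sigma=(s_1,\dots,s_n)$ of elements of $\mathbb S\setminus\{0\}$ with $s_1+\dots+s_n=t$, ordered by refinement: $\sigma\ge\tau=(t_1,\dots,t_n)$ iff $\sigma$ is a concatenation $\tau_1\smile\dots\smile\tau_n$ with $\tau_k\in\mathbb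 F_{t_k}$. Put $A_\sigma=A_{s_1}\boxtimes\dots\boxtimes A_{s_n}$ ($A_{()}=E$), let $\Delta_\sigma:A_t\to A_\sigma$ be the iterated coproduct ($\Delta_{()}=\delta$), and $\Delta^\tau_\sigma=\Delta_{\tau_1}\boxtimes\dots\boxtimes\Delta_{\tau_n}:A_\tau\to A_\sigma$ for $\tau\le\sigma$. **Theorem.** In this setting the following hold. (i) For every $t$, $((A_\tau)_{\tau\in\mathbb F_t},(\Delta^\tau_\sigma)_{\tau\le\sigma})$ is an inductive system and has an inductive limit. Let $(\mathcal A_t,(D^\tau:A_\tau\to\mathcal A_t)_{\tau\in\mathbb F_t})$ be any choice of these limits. (ii) There is a unique comonoidal system on the objects $(\mathcal A_t)_{t\in\mathbb S}$ whose coproduct morphisms $\tilde\Delta_{s,t}$ satisfy $\tilde\Delta_{s,t}\circ D^{\sigma\smile\tau}=D^\sigma\boxtimes D^\tau$ for all $\sigma\in\mathbb F_s$, $\tau\in\mathbb F_t$ and whose counit morphism $\tilde\delta$ satisfies $\tilde\delta\circ D^{()}=\mathrm{id}_E$; this system is full. (iii) For $s\le t$ let $i^s_t:\mathcal A_s\to\mathcal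 A_t$ be the composition $\mathcal A_s\xrightarrow{\iota^1}\mathcal A_s\boxtimes\mathcal A_{t-s}\xrightarrow{\tilde\Delta_{s,t-s}^{-1}}\mathcal A_t$. Then $((\mathcal A_t)_{t\in\mathbb S},(i^s_t)_{s\le t})$ is an inductive system and has an inductive limit. Let $(\mathcal A,(i^t:\mathcal A_t\to\mathcal A)_{t\in\mathbb S})$ be any choice of this limit. (iv) Let $D_t:A_t\to\mathcal A_t$ be $D^{(t)}$ if $t\neq0$, and $D_0=D^{()}\circ\delta$. For $s\le t$ let $j_{s,t}:A_{t-s}\to\mathcal A$ be the composition $$A_{t-s}\xrightarrow{D_{t-s}}\mathcal A_{t-s}\xrightarrow{\iota^2}\mathcal A_s\boxtimes\mathcal A_{t-s}\xrightarrow{\tilde\Delta_{s,t-s}^{-1}}\mathcal A_t\xrightarrow{i^t}\mathcal A.$$ Then the morphisms $(j_{s,t})_{s\le t}$ form a categorical Lévy process on $(A_t)_{t\in\mathbb S}$. -/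

import Mathlib

open CategoryTheory CategoryTheory.Limits MonoidalCategory

universe w v u v' u'

namespace CatLevy

/-! ### Inductive systems and inductive limits -/

/-- A family of objects `A a` and morphisms `f : A a ⟶ A b` for `a ≤ b`, indexed by a preordered
set `I`, is an inductive system: `I` is directed and the morphisms satisfy the functor laws. -/
structure IsInductiveSystem {I : Type w} [Preorder I] {C : Type u} [Category.{v} C]
    (A : I → C) (f : ∀ {a b : I}, a ≤ b → (A a ⟶ A b)) : Prop where
  directed : ∀ a b : I, ∃ c : I, a ≤ c ∧ b ≤ c
  map_id : ∀ a : I, f (le_refl a) = 𝟙 (A a)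
  map_comp : ∀ {a b c : I} (hab : a ≤ b) (hbc : b ≤ c), f hab ≫ f hbc = f (hab.trans hbc)

/-- An inductive system as a functor on its index set. Its inductive limits are the colimit
cocones of this functor. -/
def IsInductiveSystem.functor {I : Type w} [Preorder I] {C : Type u} [Category.{v} C]
    {A : I → C} {f : ∀ {a b : I}, a ≤ b → (A a ⟶ A b)} (h : IsInductiveSystem A f) : I ⥤ C where
  obj := A
  map g := f (leOfHom g)
  map_id a := h.map_id a
  map_comp g g' := (h.map_comp (leOfHom g) (leOfHom g')).symm

/-- All inductive systems (over nonempty directed index sets) have inductive limits. -/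
def InductivelyComplete (C : Type u) [Category.{v} C] : Prop :=
  ∀ (I : Type w) [Preorder I] [IsDirectedOrder I] [Nonempty I], HasColimitsOfShape I C

/-- The functor `F` maps inductive limits to inductive limits. -/
def PreservesInductiveLimits {C : Type u} [Category.{v} C] {D : Type u'} [Category.{v'} D]
    (F : C ⥤ D) : Prop :=
  ∀ (I : Type w) [Preorder I] [IsDirectedOrder I] [Nonempty I], PreservesColimitsOfShape I F

/-! ### Inclusions and independence when the unit object is initial -/

section Independence

variable {C : Type u} [Category.{v} C] [MonoidalCategory C] (hE : IsInitial (𝟙_ C))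

/-- The left inclusion `ι¹ : A ⟶ A ⊗ B`. -/
def incl₁ (A B : C) : A ⟶ A ⊗ B := (ρ_ A).inv ≫ (A ◁ hE.to B)

/-- The right inclusion `ι² : B ⟶ A ⊗ B`. -/
def incl₂ (A B : C) : B ⟶ A ⊗ B := (λ_ B).inv ≫ (hE.to A ▷ B)

/-- The tensor product of a finite family of objects, bracketed to the right and closed off by the
unit object: `B 0 ⊗ (B 1 ⊗ ( ⋯ ⊗ (B (n-1) ⊗ E)))`. -/
def tensorFin : ∀ {n : ℕ}, (Fin n → C) → C
  | 0, _ => 𝟙_ C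
  | _ + 1, B => B 0 ⊗ tensorFin (fun i => B i.succ)

/-- The inclusion of the `i`-th factor into the tensor product of a finite family. -/
def inclFin : ∀ {n : ℕ} (B : Fin n → C) (i : Fin n), B i ⟶ tensorFin B
  | 0, _, i => i.elim0
  | _ + 1, B, i =>
    Fin.cases (motive := fun i => B i ⟶ tensorFin B)
      (incl₁ hE (B 0) (tensorFin (fun i => B i.succ)))
      (fun k => inclFin (fun i => B i.succ) k ≫ incl₂ hE (B 0) (tensorFin (fun i => B i.succ))) i

/-- `h` is an independence morphism for `f₁` and `f₂`. -/
def IsIndependenceMorphism {B₁ B₂ A : C} (f₁ : B₁ ⟶ A) (f₂ : B₂ ⟶ A) (h : B₁ ⊗ B₂ ⟶ A) : Prop :=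
  incl₁ hE B₁ B₂ ≫ h = f₁ ∧ incl₂ hE B₁ B₂ ≫ h = f₂

/-- A finite (ordered) family of morphisms to a common target is independent. -/
def Independent {n : ℕ} {B : Fin n → C} {A : C} (f : ∀ i, B i ⟶ A) : Prop :=
  ∃ h : tensorFin B ⟶ A, ∀ i, inclFin hE B i ≫ h = f i

end Independence

/-! ### Factorizations and their refinement order -/

/-- The order of `S` is left divisibility (written additively). A totally ordered monoid is a
cancellative monoid with a linear order that has this property. -/
class LeftDivisibilityOrder (S : Type w) [AddMonoid S] [LE S] : Prop where
  le_iff : ∀ s t : S, s ≤ t ↔ ∃ p, s + p = t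

/-- The factorizations of `t`: tuples of elements different from the neutral element, with
product (here: sum) `t`. -/
structure Factorization {S : Type w} [AddMonoid S] (t : S) where
  word : List S
  sum_eq : word.sum = t
  ne_zero : ∀ s ∈ word, s ≠ 0

/-- Every partition of the letters of `P.flatten` into blocks is induced by one of `P`. -/
theorem exists_flatten_map {α β : Type w} (f : α → β) :
    ∀ (P : List (List β)) (Q : List α), Q.map f = P.flatten →
      ∃ R : List (List α), R.flatten = Q ∧ R.map (List.map f) = P
  | [], Q, h => ⟨[], by simpa using h.symm, rfl⟩
  | p :: P, Q, h => by
    rw [List.flatten_cons, List.map_eq_append_iff] at h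
    obtain ⟨Q₁, Q₂, rfl, h₁, h₂⟩ := h
    obtain ⟨R, hR, hR'⟩ := exists_flatten_map f P Q₂ h₂
    exact ⟨Q₁ :: R, by simp [hR], by simp [h₁, hR']⟩

/-- `τ ≤ σ` means that `σ` refines `τ = (t₁, …, tₙ)`: `σ` is a concatenation of tuples
`τ₁, …, τₙ`, where `τₖ` is a factorization of `tₖ`. -/
instance {S : Type w} [AddMonoid S] (t : S) : Preorder (Factorization t) where
  le τ σ := ∃ P : List (List S), P.map List.sum = τ.word ∧ P.flatten = σ.word
  le_refl τ := ⟨τ.word.map fun s => [s], by simp [Function.comp_def], by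
    induction τ.word with
    | nil => rfl
    | cons a l ih => simpa using ih⟩
  le_trans τ σ ρ := by
    rintro ⟨P, hP, hP'⟩ ⟨Q, hQ, hQ'⟩
    obtain ⟨R, rfl, hR⟩ := exists_flatten_map List.sum P Q (hQ.trans hP'.symm)
    refine ⟨R.map List.flatten, ?_, by rw [← hQ', List.flatten_flatten]⟩
    rw [← hP, ← hR]
    simp [Function.comp_def, List.sum_flatten]

/-- Concatenation of factorizations. -/
def Factorization.append {S : Type w} [AddMonoid S] {s t : S} (σ : Factorization s)
    (τ : Factorization t) : Factorization (s + t) where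
  word := σ.word ++ τ.word
  sum_eq := by rw [List.sum_append, σ.sum_eq, τ.sum_eq]
  ne_zero x hx := (List.mem_append.1 hx).elim (σ.ne_zero x) (τ.ne_zero x)

/-- The empty tuple as a factorization of the neutral element. -/
def Factorization.empty {S : Type w} [AddMonoid S] {t : S} (ht : t = 0) : Factorization t where
  word := []
  sum_eq := by simp [ht]
  ne_zero := by simp

/-- The one-letter factorization `(t)` of `t ≠ 0`. -/
def Factorization.single {S : Type w} [AddMonoid S] {t : S} (ht : t ≠ 0) : Factorization t where
  word := [t]
  sum_eq := by simp
  ne_zero := by simpa using ht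

/-! ### Comonoidal systems -/

/-- A comonoidal system over `S` on the family of objects `A`: coproduct morphisms and a counit
morphism, coassociative and counital. -/
structure ComonoidalSystem {S : Type w} [AddMonoid S] {C : Type u} [Category.{v} C]
    [MonoidalCategory C] (A : S → C) where
  comul : ∀ s t : S, A (s + t) ⟶ A s ⊗ A t
  counit : A 0 ⟶ 𝟙_ C
  coassoc : ∀ r s t : S,
    comul (r + s) t ≫ (comul r s ▷ A t) ≫ (α_ (A r) (A s) (A t)).hom =
      eqToHom (congrArg A (add_assoc r s t)) ≫ comul r (s + t) ≫ (A r ◁ comul s t)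
  counit_left : ∀ s : S,
    comul 0 s ≫ (counit ▷ A s) ≫ (λ_ (A s)).hom = eqToHom (congrArg A (zero_add s))
  counit_right : ∀ s : S,
    comul s 0 ≫ (A s ◁ counit) ≫ (ρ_ (A s)).hom = eqToHom (congrArg A (add_zero s))

/-- A comonoidal system is full if its structure morphisms are isomorphisms. -/
structure ComonoidalSystem.IsFull {S : Type w} [AddMonoid S] {C : Type u} [Category.{v} C]
    [MonoidalCategory C] {A : S → C} (X : ComonoidalSystem A) : Prop where
  isIso_comul : ∀ s t : S, IsIso (X.comul s t)
  isIso_counit : IsIso X.counit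

section First

variable {S : Type w} [AddMonoid S] {C : Type u} [Category.{v} C] [MonoidalCategory C]

/-- `A_σ = A_{s₁} ⊗ ( ⋯ ⊗ (A_{sₙ} ⊗ E))` for a tuple `σ = (s₁, …, sₙ)`. -/
def tensorWord (A : S → C) : List S → C
  | [] => 𝟙_ C
  | s :: l => A s ⊗ tensorWord A l

/-- The canonical isomorphism `A_σ ⊗ A_τ ≅ A_{σ ⌣ τ}` (associativity and unit constraints). -/
def tensorWordAppend (A : S → C) :
    ∀ l l' : List S, tensorWord A l ⊗ tensorWord A l' ≅ tensorWord A (l ++ l')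
  | [], l' => λ_ (tensorWord A l')
  | s :: l, l' => α_ (A s) (tensorWord A l) (tensorWord A l') ≪≫
      whiskerLeftIso (A s) (tensorWordAppend A l l')

variable {A : S → C} (X : ComonoidalSystem A)

/-- The iterated coproduct `Δ_σ : A_{s₁ + ⋯ + sₙ} ⟶ A_σ`. -/
def ComonoidalSystem.iter (X : ComonoidalSystem A) : ∀ l : List S, A l.sum ⟶ tensorWord A l
  | [] => X.counit
  | s :: l => X.comul s l.sum ≫ (A s ◁ ComonoidalSystem.iter X l)

/-- `Δ_{τ₁} ⊗ ⋯ ⊗ Δ_{τₙ}` for a list `P = (τ₁, …, τₙ)` of tuples. -/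
def ComonoidalSystem.iterBlocks (X : ComonoidalSystem A) :
    ∀ P : List (List S), tensorWord A (P.map List.sum) ⟶ tensorWord A P.flatten
  | [] => 𝟙 (𝟙_ C)
  | p :: P => (X.iter p ⊗ₘ ComonoidalSystem.iterBlocks X P) ≫ (tensorWordAppend A p P.flatten).hom

/-- The morphism `Δ^τ_σ : A_τ ⟶ A_σ` for a refinement `σ` of `τ`. (The decomposition of `σ` into
blocks is unique if the monoid is cancellative and conical.) -/
noncomputable def ComonoidalSystem.refine {t : S} {τ σ : Factorization t} (h : τ ≤ σ) :
    tensorWord A τ.word ⟶ tensorWord A σ.word :=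
  eqToHom (congrArg (tensorWord A) h.choose_spec.1.symm) ≫ X.iterBlocks h.choose ≫
    eqToHom (congrArg (tensorWord A) h.choose_spec.2)

/-- Given morphisms `D^τ : A_τ ⟶ 𝒜_t` for the factorizations `τ` of `t`, the morphism
`A_t ⟶ 𝒜_t`: it is `D^{(t)}` if `t ≠ 0`, and the counit of the system followed by `D^{()}`
if `t = 0`. -/
noncomputable def ComonoidalSystem.toLimit {𝒜 : S → C}
    (D : ∀ (t : S) (τ : Factorization t), tensorWord A τ.word ⟶ 𝒜 t) (t : S) : A t ⟶ 𝒜 t :=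
  open Classical in
  if ht : t = 0 then
    eqToHom (congrArg A ht) ≫ X.counit ≫ D t (Factorization.empty ht)
  else (ρ_ (A t)).inv ≫ D t (Factorization.single ht)

/-- A comonoidal system `Y` on the objects `𝒜_t` is the one generated along the morphisms
`D^τ : A_τ ⟶ 𝒜_t`: its coproduct morphisms satisfy `Δ̃_{s,t} ∘ D^{σ ⌣ τ} = D^σ ⊗ D^τ`, and its
counit morphism is the identity under the identification `D^{()}` of the unit object with `𝒜_0`. -/
structure ComonoidalSystem.IsGenerated {𝒜 : S → C} (Y : ComonoidalSystem 𝒜)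
    (D : ∀ (t : S) (τ : Factorization t), tensorWord A τ.word ⟶ 𝒜 t) : Prop where
  comul : ∀ (s t : S) (σ : Factorization s) (τ : Factorization t),
    (tensorWordAppend A σ.word τ.word).hom ≫ D (s + t) (σ.append τ) ≫ Y.comul s t =
      D s σ ⊗ₘ D t τ
  counit : D 0 (Factorization.empty rfl) ≫ Y.counit = 𝟙 (𝟙_ C)

end First

/-! ### The second inductive system and Lévy processes -/

section Second

variable {S : Type w} [AddMonoid S] {C : Type u} [Category.{v} C] [MonoidalCategory C]
  (hE : IsInitial (𝟙_ C))

/-- The inverse `𝒜_s ⊗ 𝒜_p ⟶ 𝒜_t` of the coproduct isomorphism of a full comonoidal system, where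
`t = s + p`. -/
noncomputable def ComonoidalSystem.mul {𝒜 : S → C} (Y : ComonoidalSystem 𝒜) (hY : Y.IsFull)
    {s p t : S} (h : s + p = t) : 𝒜 s ⊗ 𝒜 p ⟶ 𝒜 t :=
  haveI := hY.isIso_comul s p
  inv (Y.comul s p) ≫ eqToHom (congrArg 𝒜 h)

/-- The morphism `𝒜_s ⟶ 𝒜_s ⊗ 𝒜_p ⟶ 𝒜_t` for `s ≤ t`, where `t = s + p`. -/
noncomputable def ComonoidalSystem.stage [Preorder S] [LeftDivisibilityOrder S] {𝒜 : S → C}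
    (Y : ComonoidalSystem 𝒜) (hY : Y.IsFull) {s t : S} (h : s ≤ t) : 𝒜 s ⟶ 𝒜 t :=
  incl₁ hE (𝒜 s) (𝒜 ((LeftDivisibilityOrder.le_iff s t).1 h).choose) ≫
    Y.mul hY ((LeftDivisibilityOrder.le_iff s t).1 h).choose_spec

variable {A : S → C} (X : ComonoidalSystem A)

/-- A categorical Lévy process on the comonoidal system `X`: morphisms `j_{s,t} : A_{t-s} ⟶ B` for
`s ≤ t`. The difference `p = t - s` is carried along as the element (unique in a cancellative
monoid) with `s + p = t`. -/
structure IsLevyProcess [Preorder S] {B : C}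
    (j : ∀ {s t p : S}, s + p = t → (A p ⟶ B)) : Prop where
  zero : ∀ t : S, j (add_zero t) = X.counit ≫ hE.to B
  independent : ∀ (n : ℕ) (s t p : Fin n → S) (h : ∀ i, s i + p i = t i),
    (∀ (i : ℕ) (hi : i + 1 < n), t ⟨i, by omega⟩ ≤ s ⟨i + 1, hi⟩) →
      Independent hE (fun i => j (h i))
  increment : ∀ {r s t p q : S} (hp : r + p = s) (hq : s + q = t),
    ∃ k : A p ⊗ A q ⟶ B, IsIndependenceMorphism hE (j hp) (j hq) k ∧
      X.comul p q ≫ k = j (show r + (p + q) = t by rw [← add_assoc, hp, hq])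

/-- The morphism `j_{s,t} : A_{t-s} ⟶ 𝒜_{t-s} ⟶ 𝒜_s ⊗ 𝒜_{t-s} ⟶ 𝒜_t ⟶ L`, where `p = t - s`. -/
noncomputable def levyMorphism {𝒜 : S → C}
    (D : ∀ (t : S) (τ : Factorization t), tensorWord A τ.word ⟶ 𝒜 t)
    (Y : ComonoidalSystem 𝒜) (hY : Y.IsFull) {L : C} (i : ∀ t : S, 𝒜 t ⟶ L)
    {s t p : S} (h : s + p = t) : A p ⟶ L :=
  X.toLimit D p ≫ incl₂ hE (𝒜 s) (𝒜 p) ≫ Y.mul hY h ≫ i t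

end Second

end CatLevy

/-!
A factorization `τ` of `t` is a subdivision of an interval of length `t`, and `Δ^τ_σ` applies an
iterated coproduct to each piece. Coassociativity and the counit identities make the iterated
coproduct compatible with concatenation (`ComonoidalSystem.iterOf_append`), and this gives
functoriality of the `Δ^τ_σ` (`ComonoidalSystem.blocksOf_comp`). In a cancellative monoid in which
`s + t = 0` forces `s = t = 0`, the decomposition of a refinement into blocks is unique
(`eq_of_flatten_eq_of_map_sum_eq`), so the choice of such a decomposition does not matter. Since
the order is total, any two factorizations have a common refinement (`exists_common_refinement`).

Refining a common refinement with the subdivision at `s` shows that the concatenations `σ ⌣ τ` are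
cofinal among the factorizations of `s + t`. Hence `𝒜_{s+t}` is the limit of the objects
`A_σ ⊗ A_τ`. As the tensor product preserves inductive limits, so is `𝒜_s ⊗ 𝒜_t`, and the canonical
isomorphism between the two is the coproduct of the generated system
(`ComonoidalSystem.exists_iso_tensor`). Its coassociativity and counit identities, as well as its
uniqueness, can be checked on the jointly epimorphic `D^{σ ⌣ τ}`
(`IsLimitFamily.exists_isGenerated`, `IsLimitFamily.eq_of_isGenerated`).

The remaining assertions hold for every full comonoidal system `𝒜`: the inverse coproducts form an
associative multiplication, for which the inclusions of the first factor are the transition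
morphisms, and those of the second factor shift increments. A family of consecutive increments
becomes independent by multiplying it together (`ComonoidalSystem.exists_independence`). Finally,
`A_t ⟶ 𝒜_t` is the iterated coproduct along any factorization followed by the morphism to the
limit (`IsLimitFamily.iterOf_comp`), so these morphisms respect the coproducts, and the process
on `𝒜` restricts to one on `A`.
-/

namespace CatLevy

/-! ### Combinatorics of factorizations -/

section Words

variable {S : Type w} [AddCancelMonoid S] [LinearOrder S] [LeftDivisibilityOrder S]

/-- Zero is the least element for left divisibility, so antisymmetry of the order makes the monoid
conical. -/
theorem eq_zero_of_add_eq_zero {s t : S} (h : s + t = 0) : s = 0 ∧ t = 0 := by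
  have hs : s = 0 := le_antisymm ((LeftDivisibilityOrder.le_iff s 0).2 ⟨t, h⟩)
    ((LeftDivisibilityOrder.le_iff 0 s).2 ⟨s, zero_add s⟩)
  exact ⟨hs, by simpa [hs] using h⟩

theorem eq_nil_of_sum_eq_zero {l : List S} (hl : ∀ s ∈ l, s ≠ 0) (h : l.sum = 0) : l = [] := by
  cases l with
  | nil => rfl
  | cons a l =>
    rw [List.sum_cons] at h
    exact absurd (eq_zero_of_add_eq_zero h).1 (hl a (by simp))

/-- A decomposition into blocks is determined by the concatenation of the blocks and by their sums:
two candidates for the first block are prefixes of the same tuple, so the longer one is the shorter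
one followed by letters with sum zero. -/
theorem eq_of_flatten_eq_of_map_sum_eq :
    ∀ {P Q : List (List S)}, (∀ s ∈ P.flatten, s ≠ 0) → P.flatten = Q.flatten →
      P.map List.sum = Q.map List.sum → P = Q
  | [], [], _, _, _ => rfl
  | [], _ :: _, _, _, h => by simp at h
  | _ :: _, [], _, _, h => by simp at h
  | p :: P, q :: Q, h0, hf, hs => by
    simp only [List.map_cons, List.cons.injEq] at hs
    simp only [List.flatten_cons] at hf h0
    have hpq : p = q := by
      rcases List.append_eq_append_iff.1 hf with ⟨r, rfl, hr⟩ | ⟨r, rfl, hr⟩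
      · have : r = [] := eq_nil_of_sum_eq_zero
          (fun s hs => h0 s (by rw [hr]; simp [hs])) (by simpa using hs.1)
        simp [this]
      · have : r = [] := eq_nil_of_sum_eq_zero
          (fun s hs => h0 s (by simp [hs])) (by simpa using hs.1)
        simp [this]
    subst hpq
    rw [eq_of_flatten_eq_of_map_sum_eq (fun s hs => h0 s (by simp [hs]))
      (List.append_cancel_left hf) hs.2]

/-- Two tuples with the same sum have a common refinement: compare the first letters, and split the
larger one. -/
theorem exists_common_refinement (n : ℕ) :
    ∀ l l' : List S, l.length + l'.length ≤ n → (∀ s ∈ l, s ≠ 0) → (∀ s ∈ l', s ≠ 0) →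
      l.sum = l'.sum → ∃ P Q : List (List S), P.map List.sum = l ∧ Q.map List.sum = l' ∧
        P.flatten = Q.flatten ∧ ∀ s ∈ P.flatten, s ≠ 0 := by
  induction n with
  | zero =>
    intro l l' hn _ _ _
    obtain rfl : l = [] := List.length_eq_zero_iff.1 (by omega)
    obtain rfl : l' = [] := List.length_eq_zero_iff.1 (by omega)
    exact ⟨[], [], by simp⟩
  | succ n ih =>
    have key : ∀ (s t : S) (l l' : List S), s ≤ t → (s :: l).length + (t :: l').length ≤ n + 1 →
        (∀ x ∈ s :: l, x ≠ 0) → (∀ x ∈ t :: l', x ≠ 0) → (s :: l).sum = (t :: l').sum →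
        ∃ P Q : List (List S), P.map List.sum = s :: l ∧ Q.map List.sum = t :: l' ∧
          P.flatten = Q.flatten ∧ ∀ x ∈ P.flatten, x ≠ 0 := by
      intro s t l l' hst hn hl hl' hsum
      obtain ⟨p, rfl⟩ := (LeftDivisibilityOrder.le_iff s t).1 hst
      simp only [List.sum_cons, add_assoc, add_right_inj] at hsum
      simp only [List.length_cons] at hn
      by_cases hp : p = 0
      · obtain ⟨P, Q, hP, hQ, hPQ, h0⟩ := ih l l' (by omega)
          (fun x hx => hl x (by simp [hx])) (fun x hx => hl' x (by simp [hx]))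
          (by simpa [hp] using hsum)
        refine ⟨[s] :: P, [s] :: Q, by simp [hP], by simp [hQ, hp], by simp [hPQ], ?_⟩
        simpa using ⟨hl s (by simp), by simpa using h0⟩
      · obtain ⟨P, Q, hP, hQ, hPQ, h0⟩ := ih l (p :: l') (by simp only [List.length_cons]; omega)
          (fun x hx => hl x (by simp [hx]))
          (fun x hx => by
            rcases List.mem_cons.1 hx with rfl | hx
            · exact hp
            · exact hl' x (by simp [hx]))
          (by simpa using hsum)
        cases Q with
        | nil => simp at hQ
        | cons q Q =>
          simp only [List.map_cons, List.cons.injEq] at hQ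
          refine ⟨[s] :: P, (s :: q) :: Q, by simp [hP], by simp [hQ], ?_, ?_⟩
          · simpa using hPQ
          · simpa using ⟨hl s (by simp), by simpa using h0⟩
    intro l l' hn hl hl' hsum
    cases l with
    | nil =>
      obtain rfl := eq_nil_of_sum_eq_zero hl' (by simpa using hsum.symm)
      exact ⟨[], [], by simp⟩
    | cons s l =>
      cases l' with
      | nil => exact absurd (eq_nil_of_sum_eq_zero hl (by simpa using hsum)) (by simp)
      | cons t l' =>
        rcases le_total s t with hst | hst
        · exact key s t l l' hst hn hl hl' hsum
        · obtain ⟨Q, P, hQ, hP, hPQ, h0⟩ := key t s l' l hst (by omega) hl' hl hsum.symm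
          exact ⟨P, Q, hP, hQ, hPQ.symm, by rwa [← hPQ]⟩

end Words

namespace Factorization

section

variable {S : Type w} [AddMonoid S]

theorem ext_word {t : S} {σ τ : Factorization t} (h : σ.word = τ.word) : σ = τ := by
  cases σ; cases τ; cases h; rfl

instance (t : S) : Nonempty (Factorization t) := by
  by_cases ht : t = 0
  · exact ⟨empty ht⟩
  · exact ⟨single ht⟩

theorem append_mono {s t : S} {σ σ' : Factorization s} {τ τ' : Factorization t} (h : σ ≤ σ')
    (h' : τ ≤ τ') : σ.append τ ≤ σ'.append τ' := by
  obtain ⟨P, hP, hP'⟩ := h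
  obtain ⟨Q, hQ, hQ'⟩ := h'
  exact ⟨P ++ Q, by simp [hP, hQ, append], by simp [hP', hQ', append]⟩

theorem single_le {t : S} (ht : t ≠ 0) (τ : Factorization t) : single ht ≤ τ :=
  ⟨[τ.word], by simp [single, τ.sum_eq], by simp⟩

/-- A refinement of a concatenation is a concatenation of refinements. -/
theorem exists_eq_append {s t : S} {σ : Factorization s} {τ : Factorization t}
    {ω : Factorization (s + t)} (h : σ.append τ ≤ ω) :
    ∃ (σ' : Factorization s) (τ' : Factorization t), ω = σ'.append τ' := by
  obtain ⟨P, hP, hP'⟩ := h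
  obtain ⟨P₁, P₂, rfl, h₁, h₂⟩ := List.map_eq_append_iff.1 hP
  rw [List.flatten_append] at hP'
  refine ⟨⟨P₁.flatten, ?_, fun x hx => ω.ne_zero x (by simp [← hP', hx])⟩,
    ⟨P₂.flatten, ?_, fun x hx => ω.ne_zero x (by simp [← hP', hx])⟩, ext_word hP'.symm⟩
  · rw [List.sum_flatten, h₁, σ.sum_eq]
  · rw [List.sum_flatten, h₂, τ.sum_eq]

end

variable {S : Type w} [AddCancelMonoid S] [LinearOrder S] [LeftDivisibilityOrder S]

instance (t : S) : IsDirectedOrder (Factorization t) where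
  directed σ τ := by
    obtain ⟨P, Q, hP, hQ, hPQ, h0⟩ := exists_common_refinement _ σ.word τ.word le_rfl σ.ne_zero
      τ.ne_zero (σ.sum_eq.trans τ.sum_eq.symm)
    exact ⟨⟨P.flatten, by rw [List.sum_flatten, hP, σ.sum_eq], h0⟩, ⟨P, hP, rfl⟩,
      ⟨Q, hQ, hPQ.symm⟩⟩

/-- Concatenations are cofinal among the factorizations of `s + t`. -/
theorem exists_le_append {s t : S} (ω : Factorization (s + t)) :
    ∃ (σ : Factorization s) (τ : Factorization t), ω ≤ σ.append τ := by
  obtain ⟨ρ, h, h'⟩ := exists_ge_ge ω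
    ((Classical.arbitrary (Factorization s)).append (Classical.arbitrary (Factorization t)))
  obtain ⟨σ, τ, rfl⟩ := exists_eq_append h'
  exact ⟨σ, τ, h⟩

theorem word_eq_nil (τ : Factorization (0 : S)) : τ.word = [] :=
  eq_nil_of_sum_eq_zero τ.ne_zero τ.sum_eq

end Factorization

/-! ### Iterated coproducts -/

theorem tensorWordAppend_assoc {S : Type w} {C : Type u} [Category.{v} C] [MonoidalCategory C]
    (A : S → C) (l l' l'' : List S) :
    (tensorWordAppend A l l').hom ▷ tensorWord A l'' ≫ (tensorWordAppend A (l ++ l') l'').hom ≫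
        eqToHom (congrArg (tensorWord A) (List.append_assoc l l' l'')) =
      (α_ _ _ _).hom ≫ tensorWord A l ◁ (tensorWordAppend A l' l'').hom ≫
        (tensorWordAppend A l (l' ++ l'')).hom := by
  induction l with
  | nil =>
    simp only [List.nil_append, eqToHom_refl, Category.comp_id, tensorWordAppend, tensorWord]
    monoidal
  | cons s l ih =>
    have key : A s ◁ eqToHom (congrArg (tensorWord A) (List.append_assoc l l' l'')) =
        eqToHom (congrArg (tensorWord A) (List.append_assoc (s :: l) l' l'')) := by
      rw [whiskerLeft_eqToHom]; rfl
    rw [← key]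
    simp only [List.cons_append, List.append_eq, tensorWordAppend, tensorWord, Iso.trans_hom,
      whiskerLeftIso_hom, comp_whiskerRight, Category.assoc, ← whiskerLeft_comp,
      whisker_assoc, Iso.inv_hom_id_assoc, tensor_whiskerLeft]
    rw [← pentagon_assoc, ← whiskerLeft_comp, ← ih]

namespace ComonoidalSystem

variable {S : Type w} [AddMonoid S] {C : Type u} [Category.{v} C] [MonoidalCategory C]
  {A : S → C} (X : ComonoidalSystem A)

/-- The coproduct morphism `A_u ⟶ A_s ⊗ A_t` for an element `u` with `s + t = u`. Carrying the
equation along keeps transports between the objects `A_u` out of the computations. -/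
def comulOf {s t u : S} (h : s + t = u) : A u ⟶ A s ⊗ A t :=
  eqToHom (congrArg A h.symm) ≫ X.comul s t

/-- The iterated coproduct `A_t ⟶ A_l` for a tuple `l` with sum `t`. -/
def iterOf (l : List S) {t : S} (h : l.sum = t) : A t ⟶ tensorWord A l :=
  eqToHom (congrArg A h.symm) ≫ X.iter l

/-- The morphism `A_l ⟶ A_{l'}` for a list `P` of tuples whose sums form `l` and whose
concatenation is `l'`. -/
def blocksOf (P : List (List S)) {l l' : List S} (h : P.map List.sum = l) (h' : P.flatten = l') :
    tensorWord A l ⟶ tensorWord A l' :=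
  eqToHom (congrArg (tensorWord A) h.symm) ≫ X.iterBlocks P ≫
    eqToHom (congrArg (tensorWord A) h')

theorem comulOf_assoc {r s t a b u : S} (hrs : r + s = a) (hat : a + t = u) (hst : s + t = b)
    (hrb : r + b = u) :
    X.comulOf hat ≫ X.comulOf hrs ▷ A t ≫ (α_ (A r) (A s) (A t)).hom =
      X.comulOf hrb ≫ A r ◁ X.comulOf hst := by
  subst hrs hat hst
  simp [comulOf, X.coassoc]

theorem comulOf_counit_left {s t : S} (h : 0 + s = t) :
    X.comulOf h ≫ X.counit ▷ A s ≫ (λ_ (A s)).hom =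
      eqToHom (congrArg A (by simpa using h.symm)) := by
  subst h
  simp [comulOf, X.counit_left]

theorem comulOf_counit_right {s t : S} (h : s + 0 = t) :
    X.comulOf h ≫ A s ◁ X.counit ≫ (ρ_ (A s)).hom =
      eqToHom (congrArg A (by simpa using h.symm)) := by
  subst h
  simp [comulOf, X.counit_right]

theorem iterOf_nil : X.iterOf [] List.sum_nil = X.counit := by
  simp only [iterOf, iter]
  exact Category.id_comp _

theorem iterOf_cons {s p t : S} {l : List S} (hl : l.sum = p) (h : s + p = t) :
    X.iterOf (s :: l) (by rw [List.sum_cons, hl, h]) = X.comulOf h ≫ A s ◁ X.iterOf l hl := by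
  subst hl h
  simp only [iterOf, iter, comulOf, eqToHom_refl, Category.id_comp]
  exact Category.id_comp _

/-- The iterated coproduct along a concatenation. Coassociativity gives the induction step, the left
counit identity the empty tuple. -/
theorem iterOf_append (l l' : List S) {s t u : S} (hl : l.sum = s) (hl' : l'.sum = t)
    (h : s + t = u) :
    X.iterOf (l ++ l') (by rw [List.sum_append, hl, hl', h]) =
      X.comulOf h ≫ (X.iterOf l hl ⊗ₘ X.iterOf l' hl') ≫ (tensorWordAppend A l l').hom := by
  induction l generalizing s u with
  | nil =>
    obtain rfl : 0 = s := hl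
    obtain rfl : t = u := by simpa using h
    have e : X.iterOf [] (List.sum_nil) = X.counit := X.iterOf_nil
    change X.iterOf l' hl' = X.comulOf h ≫ (X.iterOf [] List.sum_nil ⊗ₘ X.iterOf l' hl') ≫
      (λ_ (tensorWord A l')).hom
    rw [e]
    change _ = X.comulOf h ≫ (X.counit ⊗ₘ X.iterOf l' hl') ≫ (λ_ (tensorWord A l')).hom
    rw [MonoidalCategory.tensorHom_def]
    simp [reassoc_of% (X.comulOf_counit_left h)]
  | cons a l ih =>
    have hs : a + l.sum = s := by simpa using hl
    have hu : a + (l.sum + t) = u := by rw [← add_assoc, hs, h]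
    have e₁ := X.iterOf_cons (l := l ++ l') (by rw [List.sum_append, hl']) hu
    have e₂ := X.comulOf_assoc hs h rfl hu
    refine e₁.trans ?_
    rw [ih rfl rfl, X.iterOf_cons rfl hs]
    change _ = X.comulOf h ≫ (X.comulOf hs ≫ A a ◁ X.iterOf l rfl ⊗ₘ X.iterOf l' hl') ≫
      (α_ (A a) (tensorWord A l) (tensorWord A l')).hom ≫ A a ◁ (tensorWordAppend A l l').hom
    simp only [whiskerLeft_comp]
    rw [← reassoc_of% e₂]
    simp [MonoidalCategory.tensorHom_def]

theorem blocksOf_nil : X.blocksOf [] (l := []) (l' := []) rfl rfl = 𝟙 _ := by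
  change 𝟙 (𝟙_ C) ≫ 𝟙 (𝟙_ C) ≫ 𝟙 (𝟙_ C) = 𝟙 (𝟙_ C)
  simp

theorem blocksOf_cons {p : List S} {s : S} (hp : p.sum = s) {P : List (List S)} {l l' : List S}
    (h : P.map List.sum = l) (h' : P.flatten = l') :
    X.blocksOf (p :: P) (l := s :: l) (l' := p ++ l') (by simp [hp, h]) (by simp [h']) =
      (X.iterOf p hp ⊗ₘ X.blocksOf P h h') ≫ (tensorWordAppend A p l').hom := by
  subst hp h h'
  simp only [blocksOf, iterBlocks, iterOf, eqToHom_refl, Category.id_comp, Category.comp_id]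
  rfl

theorem blocksOf_comp_eqToHom {P : List (List S)} {l l' l'' : List S}
    (h : P.map List.sum = l) (h' : P.flatten = l') (e : l' = l'') :
    X.blocksOf P h h' ≫ eqToHom (congrArg (tensorWord A) e) = X.blocksOf P h (h'.trans e) := by
  subst e; simp

theorem blocksOf_singletons (l : List S) (h : (l.map fun s => [s]).map List.sum = l)
    (h' : (l.map fun s => [s]).flatten = l) :
    X.blocksOf (l.map fun s => [s]) h h' = 𝟙 _ := by
  induction l with
  | nil => exact X.blocksOf_nil
  | cons s l ih =>
    have h₁ : (l.map fun s => [s]).map List.sum = l := (List.cons.inj h).2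
    have h₂ : (l.map fun s => [s]).flatten = l := (List.cons.inj h').2
    have := X.blocksOf_cons (p := [s]) (s := s) (by simp) h₁ h₂
    refine this.trans ?_
    have hs : X.iterOf [s] (by simp) = X.comulOf (add_zero s) ≫ A s ◁ X.counit := by
      rw [X.iterOf_cons (l := []) List.sum_nil (add_zero s), iterOf_nil]; rfl
    have := X.comulOf_counit_right (add_zero s)
    rw [ih h₁ h₂, hs]
    change (X.comulOf (add_zero s) ≫ A s ◁ X.counit ⊗ₘ 𝟙 (tensorWord A l)) ≫
      (α_ (A s) (𝟙_ C) (tensorWord A l)).hom ≫ A s ◁ (λ_ (tensorWord A l)).hom =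
        𝟙 (A s ⊗ tensorWord A l)
    rw [triangle, tensorHom_id, ← comp_whiskerRight, Category.assoc, this]
    simp

/-- The iterated coproducts factor through each other along refinements. -/
theorem iterOf_comp_blocksOf (P : List (List S)) {l l' : List S} (h : P.map List.sum = l)
    (h' : P.flatten = l') {t : S} (hl : l.sum = t) (hl' : l'.sum = t) :
    X.iterOf l hl ≫ X.blocksOf P h h' = X.iterOf l' hl' := by
  induction P generalizing l l' t with
  | nil =>
    obtain rfl : [] = l := h
    obtain rfl : [] = l' := h'
    rw [blocksOf_nil, Category.comp_id]
  | cons p P ih =>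
    subst h h'
    have ht : p.sum + (P.map List.sum).sum = t := by simpa using hl
    refine Eq.trans ?_ (X.iterOf_append p P.flatten rfl List.sum_flatten ht).symm
    rw [← ih (t := (P.map List.sum).sum) rfl rfl rfl]
    have h₁ := X.blocksOf_cons (p := p) rfl (P := P) rfl rfl
    have h₂ := X.iterOf_cons (s := p.sum) (l := P.map List.sum) rfl ht
    refine (congrArg₂ (· ≫ ·) h₂ h₁).trans ?_
    refine (Category.assoc _ _ _).trans ?_
    simp only [tensorHom_def', whiskerLeft_comp, Category.assoc]
    rfl

/-- The induction step for the compatibility of `blocksOf` with concatenation, for arbitrary objects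
in place of the tensor products of tuples. -/
theorem whiskerLeft_comp_tensorHom_of_comm {a a' b b' c c' d d' e z : C} (f : a ⟶ a')
    {g : b ⟶ b'} {k : c ⟶ c'} {p : b ⊗ c ⟶ d} {q : b' ⊗ c' ⟶ d'} {m : d ⟶ d'}
    (h : p ≫ m = (g ⊗ₘ k) ≫ q) {u : a' ⊗ b' ⟶ e} {x : e ⊗ c' ⟶ z} {y : a' ⊗ d' ⟶ z}
    (h' : u ▷ c' ≫ x = (α_ a' b' c').hom ≫ a' ◁ q ≫ y) :
    ((α_ a b c).hom ≫ a ◁ p) ≫ (f ⊗ₘ m) ≫ y = ((f ⊗ₘ g) ≫ u ⊗ₘ k) ≫ x := by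
  have h₁ : ((f ⊗ₘ g) ≫ u ⊗ₘ k) = ((f ⊗ₘ g) ⊗ₘ k) ≫ u ▷ c' := by
    rw [tensorHom_comp_whiskerRight]
  rw [h₁, Category.assoc, Category.assoc, h', associator_naturality_assoc,
    whiskerLeft_comp_tensorHom_assoc, h, tensorHom_comp_whiskerLeft_assoc]

theorem tensorWordAppend_comp_blocksOf_append (P Q : List (List S)) {l l' m m' : List S}
    (h : P.map List.sum = l) (h' : P.flatten = l') (k : Q.map List.sum = m)
    (k' : Q.flatten = m') :
    (tensorWordAppend A l m).hom ≫ X.blocksOf (P ++ Q) (l := l ++ m) (l' := l' ++ m')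
        (by simp [h, k]) (by simp [h', k']) =
      (X.blocksOf P h h' ⊗ₘ X.blocksOf Q k k') ≫ (tensorWordAppend A l' m').hom := by
  induction P generalizing l l' with
  | nil =>
    obtain rfl : [] = l := h
    obtain rfl : [] = l' := h'
    rw [blocksOf_nil]
    simp only [tensorWordAppend, tensorWord]
    simp
  | cons p P ih =>
    subst h h'
    have h₁ := X.blocksOf_cons (p := p) rfl (P := P) rfl rfl
    have h₂ := X.blocksOf_cons (p := p) rfl (P := P ++ Q) (l := P.map List.sum ++ m)
      (l' := P.flatten ++ m') (by simp [k]) (by simp [k'])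
    have h₃ := X.blocksOf_comp_eqToHom (P := p :: (P ++ Q)) (l := p.sum :: (P.map List.sum ++ m))
      (l' := (p ++ P.flatten) ++ m') (by simp [k]) (by simp [k'])
      (List.append_assoc p P.flatten m')
    -- The target is the tensor product over `(p ++ P.flatten) ++ m'`, reassociated for `h₂`.
    rw [← cancel_mono (eqToHom (congrArg (tensorWord A) (List.append_assoc p P.flatten m')))]
    refine (Category.assoc _ _ _).trans ((congrArg (_ ≫ ·) (h₃.trans h₂)).trans ?_)
    refine Eq.trans ?_ (congrArg (fun f => (f ⊗ₘ X.blocksOf Q k k') ≫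
      (tensorWordAppend A (p ++ P.flatten) m').hom ≫
      eqToHom (congrArg (tensorWord A) (List.append_assoc p P.flatten m'))) h₁.symm |>.trans
        (Category.assoc _ _ _).symm)
    exact whiskerLeft_comp_tensorHom_of_comm _ (ih rfl rfl)
      (tensorWordAppend_assoc A p P.flatten m')

/-- Functoriality of `blocksOf`: a refinement of a refinement is given by a list `R` of lists of
blocks. -/
theorem blocksOf_comp (R : List (List (List S))) {l l' l'' : List S}
    (h₁ : (R.map (List.map List.sum)).map List.sum = l)
    (h₂ : (R.map (List.map List.sum)).flatten = l') (h₃ : R.flatten.map List.sum = l')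
    (h₄ : R.flatten.flatten = l'') (h₅ : (R.map List.flatten).map List.sum = l)
    (h₆ : (R.map List.flatten).flatten = l'') :
    X.blocksOf (R.map (List.map List.sum)) h₁ h₂ ≫ X.blocksOf R.flatten h₃ h₄ =
      X.blocksOf (R.map List.flatten) h₅ h₆ := by
  induction R generalizing l l' l'' with
  | nil =>
    obtain rfl : [] = l := h₁
    obtain rfl : [] = l' := h₂
    obtain rfl : [] = l'' := h₄
    exact (congrArg (· ≫ X.blocksOf [] rfl rfl) X.blocksOf_nil).trans (Category.id_comp _)
  | cons r R ih =>
    subst h₁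
    obtain rfl : r.map List.sum ++ (R.map (List.map List.sum)).flatten = l' := h₂
    obtain rfl : r.flatten ++ R.flatten.flatten = l'' := by rw [← h₄]; simp
    have e₁ := X.blocksOf_cons (p := r.map List.sum) rfl (P := R.map (List.map List.sum)) rfl rfl
    have e₂ := X.tensorWordAppend_comp_blocksOf_append r R.flatten rfl rfl
      (m := (R.map (List.map List.sum)).flatten) (by simp [List.map_flatten]) rfl
    have e₃ := X.blocksOf_cons (p := r.flatten) (s := (r.map List.sum).sum)
      (by rw [List.sum_flatten]) (P := R.map List.flatten)
      (l := (R.map (List.map List.sum)).map List.sum) (l' := R.flatten.flatten)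
      (by simp [Function.comp_def, List.sum_flatten]) List.flatten_flatten.symm
    refine Eq.trans ?_ e₃.symm
    refine (congrArg (· ≫ _) e₁).trans ((Category.assoc _ _ _).trans
      ((congrArg (_ ≫ ·) e₂).trans ?_))
    rw [← ih rfl rfl (by simp [List.map_flatten]) rfl,
      ← X.iterOf_comp_blocksOf r (l := r.map List.sum) rfl rfl rfl (List.sum_flatten)]
    exact tensorHom_comp_tensorHom_assoc _ _ _ _ _

end ComonoidalSystem

/-! ### The inductive systems of factorizations -/

section Refine

variable {S : Type w} [AddCancelMonoid S] [LinearOrder S] [LeftDivisibilityOrder S]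
  {C : Type u} [Category.{v} C] [MonoidalCategory C] {A : S → C} (X : ComonoidalSystem A)

/-- The morphism `Δ^τ_σ` can be computed from any decomposition of `σ` into blocks, because there
is only one. -/
theorem ComonoidalSystem.refine_eq {t : S} {τ σ : Factorization t} (h : τ ≤ σ)
    {P : List (List S)} (hP : P.map List.sum = τ.word) (hP' : P.flatten = σ.word) :
    X.refine h = X.blocksOf P hP hP' := by
  obtain rfl : h.choose = P := eq_of_flatten_eq_of_map_sum_eq
    (by rw [h.choose_spec.2]; exact σ.ne_zero) (h.choose_spec.2.trans hP'.symm)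
    (h.choose_spec.1.trans hP.symm)
  rfl

theorem ComonoidalSystem.isInductiveSystem_refine (t : S) :
    IsInductiveSystem (fun τ : Factorization t => tensorWord A τ.word) (fun h => X.refine h) where
  directed := exists_ge_ge
  map_id τ := by
    have h : (τ.word.map fun s => [s]).map List.sum = τ.word := by simp [Function.comp_def]
    have h' : (τ.word.map fun s => [s]).flatten = τ.word := by
      induction τ.word with
      | nil => rfl
      | cons a l ih => simpa using ih
    rw [X.refine_eq _ h h', X.blocksOf_singletons]
  map_comp {τ σ ρ} h h' := by
    obtain ⟨P, hP, hP'⟩ := id h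
    obtain ⟨Q, hQ, hQ'⟩ := id h'
    obtain ⟨R, rfl, rfl⟩ := exists_flatten_map List.sum P Q (hQ.trans hP'.symm)
    have h₅ : (R.map List.flatten).map List.sum = τ.word := by
      rw [← hP]; simp [Function.comp_def, List.sum_flatten]
    have h₆ : (R.map List.flatten).flatten = ρ.word := by rw [← hQ', List.flatten_flatten]
    rw [X.refine_eq h hP hP', X.refine_eq h' hQ hQ', X.refine_eq (h.trans h') h₅ h₆,
      X.blocksOf_comp]

/-- Naturality of the isomorphism `A_σ ⊗ A_τ ≅ A_{σ ⌣ τ}` in `σ` and `τ`. -/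
theorem ComonoidalSystem.tensorWordAppend_comp_refine {s t : S} {σ σ' : Factorization s}
    {τ τ' : Factorization t} (h : σ ≤ σ') (h' : τ ≤ τ') :
    (tensorWordAppend A σ.word τ.word).hom ≫ X.refine (Factorization.append_mono h h') =
      (X.refine h ⊗ₘ X.refine h') ≫ (tensorWordAppend A σ'.word τ'.word).hom := by
  obtain ⟨P, hP, hP'⟩ := id h
  obtain ⟨Q, hQ, hQ'⟩ := id h'
  rw [X.refine_eq h hP hP', X.refine_eq h' hQ hQ',
    ← X.tensorWordAppend_comp_blocksOf_append P Q hP hP' hQ hQ', X.refine_eq]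
  rfl

theorem ComonoidalSystem.iterOf_comp_refine {t : S} {τ σ : Factorization t} (h : τ ≤ σ) :
    X.iterOf τ.word τ.sum_eq ≫ X.refine h = X.iterOf σ.word σ.sum_eq := by
  obtain ⟨P, hP, hP'⟩ := id h
  rw [X.refine_eq h hP hP', X.iterOf_comp_blocksOf]

end Refine

/-! ### Colimits of tensor products -/

section TensorColimit

/-- The product preorder on pairs of factorizations. (A separate type, so that it is not confused
with the product of the two categories.) -/
def FactorizationPair {S : Type w} [AddMonoid S] (s t : S) : Type w :=
  Factorization s × Factorization t

namespace FactorizationPair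

section

variable {S : Type w} [AddMonoid S] (s t : S)

instance : Preorder (FactorizationPair s t) :=
  inferInstanceAs (Preorder (Factorization s × Factorization t))

instance : Nonempty (FactorizationPair s t) :=
  inferInstanceAs (Nonempty (Factorization s × Factorization t))

/-- The first projection. -/
def fst : FactorizationPair s t ⥤ Factorization s :=
  Monotone.functor (f := fun x : FactorizationPair s t => x.1) fun _ _ h => h.1

/-- The second projection. -/
def snd : FactorizationPair s t ⥤ Factorization t :=
  Monotone.functor (f := fun x : FactorizationPair s t => x.2) fun _ _ h => h.2

/-- Concatenation. -/
def append : FactorizationPair s t ⥤ Factorization (s + t) :=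
  Monotone.functor (f := fun x : FactorizationPair s t => x.1.append x.2)
    fun _ _ h => Factorization.append_mono h.1 h.2

end

variable {S : Type w} [AddCancelMonoid S] [LinearOrder S] [LeftDivisibilityOrder S] (s t : S)

instance : IsDirectedOrder (FactorizationPair s t) where
  directed x y := by
    obtain ⟨a, ha, ha'⟩ := exists_ge_ge x.1 y.1
    obtain ⟨b, hb, hb'⟩ := exists_ge_ge x.2 y.2
    exact ⟨(a, b), ⟨ha, hb⟩, ⟨ha', hb'⟩⟩

instance : (fst s t).Final :=
  (Monotone.final_functor_iff _).2 fun a => ⟨(a, Classical.arbitrary _), le_rfl⟩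

instance : (snd s t).Final :=
  (Monotone.final_functor_iff _).2 fun a => ⟨(Classical.arbitrary _, a), le_rfl⟩

instance : (append s t).Final :=
  (Monotone.final_functor_iff _).2 fun a =>
    let ⟨σ, τ, h⟩ := Factorization.exists_le_append a
    ⟨(σ, τ), h⟩

end FactorizationPair

/-- A cocone in a product category, built from its two components. -/
def coconeProd {J : Type w} [Category.{v'} J] {C : Type u} [Category.{v} C] {F G : J ⥤ C}
    (c : Cocone F) (d : Cocone G) : Cocone (F.prod' G) where
  pt := (c.pt, d.pt)
  ι :=
    { app := fun j => (c.ι.app j, d.ι.app j)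
      naturality := fun i j f => by
        ext
        · exact c.ι.naturality f
        · exact d.ι.naturality f }

/-- Colimits in a product category are formed componentwise. -/
def isColimitCoconeProd {J : Type w} [Category.{v'} J] {C : Type u} [Category.{v} C] {F G : J ⥤ C}
    {c : Cocone F} {d : Cocone G} (hc : IsColimit c) (hd : IsColimit d) :
    IsColimit (coconeProd c d) where
  desc s := (hc.desc ⟨s.pt.1, { app := fun j => (s.ι.app j).1,
                                naturality := fun _ _ f => congrArg Prod.fst (s.ι.naturality f) }⟩,
    hd.desc ⟨s.pt.2, { app := fun j => (s.ι.app j).2,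
                       naturality := fun _ _ f => congrArg Prod.snd (s.ι.naturality f) }⟩)
  fac s j := by
    ext
    · exact hc.fac _ j
    · exact hd.fac _ j
  uniq s m h := by
    ext
    · exact hc.uniq ⟨s.pt.1, _⟩ _ fun j => congrArg Prod.fst (h j)
    · exact hd.uniq ⟨s.pt.2, _⟩ _ fun j => congrArg Prod.snd (h j)

variable {S : Type w} [AddCancelMonoid S] [LinearOrder S] [LeftDivisibilityOrder S]
  {C : Type u} [Category.{v} C] [MonoidalCategory C] {A : S → C} (X : ComonoidalSystem A)

/-- Both `𝒜_{s+t}` and `𝒜_s ⊗ 𝒜_t` are limits of the objects `A_σ ⊗ A_τ = A_{σ ⌣ τ}`: the former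
because concatenations are cofinal, the latter because the tensor product preserves inductive
limits. -/
theorem ComonoidalSystem.exists_iso_tensor (hT : PreservesInductiveLimits.{w} (tensor C))
    (L : ∀ t : S, ColimitCocone (X.isInductiveSystem_refine t).functor) (s t : S) :
    ∃ e : (L (s + t)).cocone.pt ≅ (L s).cocone.pt ⊗ (L t).cocone.pt,
      ∀ (σ : Factorization s) (τ : Factorization t),
        (tensorWordAppend A σ.word τ.word).hom ≫
          ((L (s + t)).cocone.ι.app (σ.append τ) : tensorWord A (σ.append τ).word ⟶ _) ≫ e.hom =
        ((L s).cocone.ι.app σ ⊗ₘ (L t).cocone.ι.app τ) := by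
  have := hT (FactorizationPair s t)
  let hs := (Functor.Final.isColimitWhiskerEquiv (FactorizationPair.fst s t) _).symm (L s).isColimit
  let ht := (Functor.Final.isColimitWhiskerEquiv (FactorizationPair.snd s t) _).symm (L t).isColimit
  let hst := (Functor.Final.isColimitWhiskerEquiv (FactorizationPair.append s t) _).symm
    (L (s + t)).isColimit
  let h := isColimitOfPreserves (tensor C) (isColimitCoconeProd hs ht)
  let w : (FactorizationPair.append s t ⋙ (X.isInductiveSystem_refine (s + t)).functor) ≅
      (FactorizationPair.fst s t ⋙ (X.isInductiveSystem_refine s).functor).prod'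
        (FactorizationPair.snd s t ⋙ (X.isInductiveSystem_refine t).functor) ⋙ tensor C :=
    (NatIso.ofComponents
      (fun x : FactorizationPair s t => tensorWordAppend A x.1.word x.2.word) fun {x y} f =>
      have hf : x ≤ y := leOfHom f
      (X.tensorWordAppend_comp_refine hf.1 hf.2).symm).symm
  refine ⟨hst.coconePointsIsoOfNatIso h w, fun σ τ => ?_⟩
  have := hst.comp_coconePointsIsoOfNatIso_hom h w (σ, τ)
  exact ((tensorWordAppend A σ.word τ.word).eq_inv_comp).1 this |>.symm ▸ rfl

end TensorColimit

/-! ### The generated comonoidal system -/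

theorem tensorWordAppend_nil_right {S : Type w} {C : Type u} [Category.{v} C] [MonoidalCategory C]
    (A : S → C) (l : List S) :
    (tensorWordAppend A l []).hom ≫ eqToHom (congrArg (tensorWord A) (List.append_nil l)) =
      (ρ_ (tensorWord A l)).hom := by
  induction l with
  | nil =>
    change (λ_ (𝟙_ C)).hom ≫ 𝟙 (𝟙_ C) = (ρ_ (𝟙_ C)).hom
    rw [Category.comp_id, unitors_equal]
  | cons s l ih =>
    have key : A s ◁ eqToHom (congrArg (tensorWord A) (List.append_nil l)) =
        eqToHom (congrArg (tensorWord A) (List.append_nil (s :: l))) := by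
      rw [whiskerLeft_eqToHom]; rfl
    rw [← key]
    refine (Category.assoc _ _ _).trans ?_
    refine (congrArg (_ ≫ ·) (whiskerLeft_comp _ _ _)).symm.trans ?_
    rw [ih]
    exact (rightUnitor_tensor_hom _ _).symm

section LimitFamily

variable {S : Type w} [AddMonoid S]
  {C : Type u} [Category.{v} C] [MonoidalCategory C] {A : S → C}

/-- The canonical isomorphism `A_σ ⊗ A_τ ≅ A_{σ ⌣ τ}` for factorizations `σ` and `τ`. -/
def Factorization.appendIso (A : S → C) {s t : S} (σ : Factorization s) (τ : Factorization t) :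
    tensorWord A σ.word ⊗ tensorWord A τ.word ≅ tensorWord A (σ.append τ).word :=
  tensorWordAppend A σ.word τ.word

/-- The properties of the inductive limits `D^τ : A_τ ⟶ 𝒜_t` from which the generated comonoidal
system is built: the `D^τ` form a jointly epimorphic cocone, `𝒜_{s+t}` is identified with
`𝒜_s ⊗ 𝒜_t`, and `𝒜_0` with the unit object. -/
structure IsLimitFamily (X : ComonoidalSystem A) {𝒜 : S → C}
    (D : ∀ (t : S) (τ : Factorization t), tensorWord A τ.word ⟶ 𝒜 t) : Prop where
  w : ∀ {t : S} {τ σ : Factorization t} (h : τ ≤ σ), X.refine h ≫ D t σ = D t τ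
  hom_ext : ∀ {t : S} {Z : C} {f g : 𝒜 t ⟶ Z}, (∀ τ, D t τ ≫ f = D t τ ≫ g) → f = g
  exists_iso : ∀ s t : S, ∃ e : 𝒜 (s + t) ≅ 𝒜 s ⊗ 𝒜 t,
    ∀ (σ : Factorization s) (τ : Factorization t),
      (σ.appendIso A τ).hom ≫ D (s + t) (σ.append τ) ≫ e.hom = (D s σ ⊗ₘ D t τ)
  isIso_empty : IsIso (D 0 (Factorization.empty rfl))

/-- Transport along `t = t'` identifies `D^σ` and `D^{σ'}` if the two factorizations are the same
tuple. -/
theorem comp_eqToHom_of_word_eq {𝒜 : S → C}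
    (D : ∀ (t : S) (τ : Factorization t), tensorWord A τ.word ⟶ 𝒜 t) {t t' : S} (h : t = t')
    {σ : Factorization t} {σ' : Factorization t'} (hw : σ.word = σ'.word) :
    D t σ ≫ eqToHom (congrArg 𝒜 h) = eqToHom (congrArg (tensorWord A) hw) ≫ D t' σ' := by
  subst h
  obtain rfl := Factorization.ext_word hw
  simp

namespace IsLimitFamily

variable {X : ComonoidalSystem A} {𝒜 : S → C}
    {D : ∀ (t : S) (τ : Factorization t), tensorWord A τ.word ⟶ 𝒜 t}

theorem hom_ext_of_le (hD : IsLimitFamily X D) {t : S} {Z : C} {f g : 𝒜 t ⟶ Z}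
    (h : ∀ τ, ∃ σ, τ ≤ σ ∧ D t σ ≫ f = D t σ ≫ g) : f = g :=
  hD.hom_ext fun τ => by
    obtain ⟨σ, hle, hσ⟩ := h τ
    rw [← hD.w hle, Category.assoc, hσ, Category.assoc]

end IsLimitFamily

end LimitFamily

section Generated

variable {S : Type w} [AddCancelMonoid S] [LinearOrder S] [LeftDivisibilityOrder S]
  {C : Type u} [Category.{v} C] [MonoidalCategory C] {A : S → C}

theorem ComonoidalSystem.isLimitFamily (X : ComonoidalSystem A)
    (hT : PreservesInductiveLimits.{w} (tensor C))
    (L : ∀ t : S, ColimitCocone (X.isInductiveSystem_refine t).functor) :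
    IsLimitFamily X (𝒜 := fun t => (L t).cocone.pt) (fun t τ => (L t).cocone.ι.app τ) where
  w h := (L _).cocone.w (homOfLE h)
  hom_ext h := (L _).isColimit.hom_ext h
  exists_iso := X.exists_iso_tensor hT L
  isIso_empty := by
    have h : IsTerminal (Factorization.empty rfl : Factorization (0 : S)) :=
      IsTerminal.ofUniqueHom
        (fun τ => eqToHom (Factorization.ext_word (Factorization.word_eq_nil τ)))
        (fun _ _ => Subsingleton.elim _ _)
    exact (L 0).isColimit.isIso_ι_app_of_isTerminal _ h

namespace IsLimitFamily

variable {X : ComonoidalSystem A} {𝒜 : S → C}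
  {D : ∀ (t : S) (τ : Factorization t), tensorWord A τ.word ⟶ 𝒜 t}

theorem hom_ext_append (hD : IsLimitFamily X D) {s t : S} {Z : C} {f g : 𝒜 (s + t) ⟶ Z}
    (h : ∀ (σ : Factorization s) (τ : Factorization t),
      (σ.appendIso A τ).hom ≫ D (s + t) (σ.append τ) ≫ f =
        (σ.appendIso A τ).hom ≫ D (s + t) (σ.append τ) ≫ g) : f = g :=
  hD.hom_ext_of_le fun ω => by
    obtain ⟨σ, τ, hle⟩ := Factorization.exists_le_append ω
    exact ⟨_, hle, (cancel_epi (σ.appendIso A τ).hom).1 (h σ τ)⟩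

/-- The inductive limits `𝒜_t` carry a comonoidal system generated along the `D^τ`, and it is
full. -/
theorem exists_isGenerated (hD : IsLimitFamily X D) :
    ∃ Y : ComonoidalSystem 𝒜, Y.IsGenerated D ∧ Y.IsFull := by
  choose e he using hD.exists_iso
  let d : 𝟙_ C ⟶ 𝒜 0 := D 0 (Factorization.empty rfl)
  have : IsIso d := hD.isIso_empty
  refine ⟨⟨fun s t => (e s t).hom, inv d, ?_, ?_, ?_⟩, ⟨he, IsIso.hom_inv_id d⟩,
    ⟨fun s t => (e s t).isIso_hom, inferInstance⟩⟩
  · intro r s t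
    refine hD.hom_ext_of_le fun ω => ?_
    obtain ⟨κ, τ, h⟩ := Factorization.exists_le_append ω
    obtain ⟨ρ, σ, h'⟩ := Factorization.exists_le_append κ
    refine ⟨(ρ.append σ).append τ, h.trans (Factorization.append_mono h' le_rfl), ?_⟩
    -- Both sides become `D^ρ ⊗ (D^σ ⊗ D^τ)` on `(A_ρ ⊗ A_σ) ⊗ A_τ`.
    rw [← cancel_epi ((ρ.append σ).appendIso A τ).hom,
      ← cancel_epi ((ρ.appendIso A σ).hom ▷ tensorWord A τ.word)]
    have hw : ((ρ.append σ).append τ).word = (ρ.append (σ.append τ)).word :=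
      List.append_assoc _ _ _
    have e₁ := comp_eqToHom_of_word_eq D (add_assoc r s t) hw
    have e₂ : (ρ.appendIso A σ).hom ▷ tensorWord A τ.word ≫ ((ρ.append σ).appendIso A τ).hom ≫
        eqToHom (congrArg (tensorWord A) hw) =
      (α_ _ _ _).hom ≫ tensorWord A ρ.word ◁ (σ.appendIso A τ).hom ≫
        (ρ.appendIso A (σ.append τ)).hom := tensorWordAppend_assoc A ρ.word σ.word τ.word
    have lhs : (ρ.appendIso A σ).hom ▷ tensorWord A τ.word ≫ ((ρ.append σ).appendIso A τ).hom ≫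
        D (r + s + t) ((ρ.append σ).append τ) ≫ (e (r + s) t).hom ≫ (e r s).hom ▷ 𝒜 t ≫
          (α_ (𝒜 r) (𝒜 s) (𝒜 t)).hom = (α_ _ _ _).hom ≫ (D r ρ ⊗ₘ D s σ ⊗ₘ D t τ) := by
      rw [reassoc_of% (he (r + s) t (ρ.append σ) τ), tensorHom_comp_whiskerRight_assoc,
        whiskerRight_comp_tensorHom_assoc, he, associator_naturality]
    have rhs : (ρ.appendIso A σ).hom ▷ tensorWord A τ.word ≫ ((ρ.append σ).appendIso A τ).hom ≫
        D (r + s + t) ((ρ.append σ).append τ) ≫ eqToHom (congrArg 𝒜 (add_assoc r s t)) ≫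
          (e r (s + t)).hom ≫ 𝒜 r ◁ (e s t).hom =
            (α_ _ _ _).hom ≫ (D r ρ ⊗ₘ D s σ ⊗ₘ D t τ) := by
      rw [reassoc_of% e₁, reassoc_of% e₂, reassoc_of% (he r (s + t) ρ (σ.append τ)),
        tensorHom_comp_whiskerLeft, whiskerLeft_comp_tensorHom, he]
    exact lhs.trans rhs.symm
  · intro s
    refine hD.hom_ext_append fun σ τ => ?_
    obtain rfl : σ = Factorization.empty rfl :=
      Factorization.ext_word (Factorization.word_eq_nil σ)
    have e₁ := comp_eqToHom_of_word_eq D (zero_add s)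
      (σ := (Factorization.empty rfl).append τ) (σ' := τ) rfl
    rw [reassoc_of% (he 0 s (Factorization.empty rfl) τ), e₁]
    change (d ⊗ₘ D s τ) ≫ inv d ▷ 𝒜 s ≫ (λ_ (𝒜 s)).hom =
      (λ_ (tensorWord A τ.word)).hom ≫ 𝟙 (tensorWord A τ.word) ≫ D s τ
    rw [tensorHom_comp_whiskerRight_assoc, IsIso.hom_inv_id]
    simp
  · intro s
    refine hD.hom_ext_append fun τ σ => ?_
    obtain rfl : σ = Factorization.empty rfl :=
      Factorization.ext_word (Factorization.word_eq_nil σ)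
    have e₁ := comp_eqToHom_of_word_eq D (add_zero s)
      (σ := τ.append (Factorization.empty rfl)) (σ' := τ) (List.append_nil _)
    have e₂ : (τ.appendIso A (Factorization.empty rfl)).hom ≫
        eqToHom (congrArg (tensorWord A) (List.append_nil τ.word)) =
          (ρ_ (tensorWord A τ.word)).hom := tensorWordAppend_nil_right A τ.word
    rw [reassoc_of% (he s 0 τ (Factorization.empty rfl)), e₁, reassoc_of% e₂]
    change (D s τ ⊗ₘ d) ≫ 𝒜 s ◁ inv d ≫ (ρ_ (𝒜 s)).hom = _
    rw [tensorHom_comp_whiskerLeft_assoc, IsIso.hom_inv_id, tensorHom_id]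
    exact rightUnitor_naturality _

theorem eq_of_isGenerated (hD : IsLimitFamily X D) {Y Y' : ComonoidalSystem 𝒜}
    (hY : Y.IsGenerated D) (hY' : Y'.IsGenerated D) : Y = Y' := by
  have := hD.isIso_empty
  have h₁ : Y.comul = Y'.comul := by
    funext s t
    exact hD.hom_ext_append fun σ τ => (hY.comul s t σ τ).trans (hY'.comul s t σ τ).symm
  have h₂ : Y.counit = Y'.counit := by
    rw [← cancel_epi (D 0 (Factorization.empty rfl)), hY.counit, hY'.counit]
  cases Y; cases Y'; cases h₁; cases h₂; rfl

/-- The morphism `A_t ⟶ 𝒜_t` is the iterated coproduct followed by `D^τ`, for every factorization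
`τ` of `t`. This treats the cases `t = 0` and `t ≠ 0` uniformly. -/
theorem iterOf_comp (hD : IsLimitFamily X D) {t : S} (τ : Factorization t) :
    X.iterOf τ.word τ.sum_eq ≫ D t τ = X.toLimit D t := by
  by_cases ht : t = 0
  · subst ht
    obtain rfl : τ = Factorization.empty rfl :=
      Factorization.ext_word (Factorization.word_eq_nil τ)
    rw [ComonoidalSystem.toLimit, dif_pos rfl, eqToHom_refl, Category.id_comp]
    exact congrArg (· ≫ D 0 (Factorization.empty rfl)) X.iterOf_nil
  · rw [ComonoidalSystem.toLimit, dif_neg ht, ← X.iterOf_comp_refine (Factorization.single_le ht τ),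
      Category.assoc, hD.w]
    congr 1
    have h₁ : X.iterOf [t] (by simp) = X.comulOf (add_zero t) ≫ A t ◁ X.counit := by
      rw [X.iterOf_cons (l := []) List.sum_nil (add_zero t), X.iterOf_nil]; rfl
    refine h₁.trans ?_
    exact (Iso.eq_comp_inv _).2 ((Category.assoc _ _ _).trans (X.comulOf_counit_right _)) |>.trans
      (Category.id_comp _)

/-- The morphisms `A_t ⟶ 𝒜_t` respect the coproducts. -/
theorem toLimit_comp_comul (hD : IsLimitFamily X D) {Y : ComonoidalSystem 𝒜}
    (hY : Y.IsGenerated D) (s t : S) :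
    X.toLimit D (s + t) ≫ Y.comul s t = X.comul s t ≫ (X.toLimit D s ⊗ₘ X.toLimit D t) := by
  let σ : Factorization s := Classical.arbitrary _
  let τ : Factorization t := Classical.arbitrary _
  rw [← hD.iterOf_comp (σ.append τ), ← hD.iterOf_comp σ, ← hD.iterOf_comp τ,
    ← tensorHom_comp_tensorHom, ← hY.comul s t σ τ]
  have e₁ : X.iterOf (σ.append τ).word (σ.append τ).sum_eq = X.comul s t ≫
      (X.iterOf σ.word σ.sum_eq ⊗ₘ X.iterOf τ.word τ.sum_eq) ≫ (σ.appendIso A τ).hom :=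
    (X.iterOf_append σ.word τ.word σ.sum_eq τ.sum_eq rfl).trans
      (congrArg (· ≫ _) (Category.id_comp _))
  simp only [e₁, Category.assoc]
  rfl

end IsLimitFamily

end Generated

/-! ### Inclusions -/

section Inclusions

variable {C : Type u} [Category.{v} C] [MonoidalCategory C] (hE : IsInitial (𝟙_ C))

theorem incl₁_comp_tensorHom {B B' D D' : C} (f : B ⟶ B') (g : D ⟶ D') :
    incl₁ hE B D ≫ (f ⊗ₘ g) = f ≫ incl₁ hE B' D' := by
  have h : hE.to D ≫ g = hE.to D' := hE.hom_ext _ _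
  rw [incl₁, incl₁, Category.assoc, whiskerLeft_comp_tensorHom, h, MonoidalCategory.tensorHom_def,
    ← rightUnitor_inv_naturality_assoc]

theorem incl₂_comp_tensorHom {B B' D D' : C} (f : B ⟶ B') (g : D ⟶ D') :
    incl₂ hE B D ≫ (f ⊗ₘ g) = g ≫ incl₂ hE B' D' := by
  have h : hE.to B ≫ f = hE.to B' := hE.hom_ext _ _
  rw [incl₂, incl₂, Category.assoc, whiskerRight_comp_tensorHom, h, tensorHom_def',
    ← leftUnitor_inv_naturality_assoc]

theorem incl₁_comp_associator_hom (B D F : C) :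
    incl₁ hE (B ⊗ D) F ≫ (α_ B D F).hom = B ◁ incl₁ hE D F := by
  simp [incl₁]

theorem incl₂_comp_associator_inv (B D F : C) :
    incl₂ hE B (D ⊗ F) ≫ (α_ B D F).inv = incl₂ hE B D ▷ F := by
  simp [incl₂]

theorem incl₁_comp_incl₁ (B D F : C) :
    incl₁ hE B D ≫ incl₁ hE (B ⊗ D) F ≫ (α_ B D F).hom = incl₁ hE B (D ⊗ F) := by
  rw [incl₁_comp_associator_hom, ← id_tensorHom, incl₁_comp_tensorHom, Category.id_comp]

theorem incl₂_comp_incl₂ (B D F : C) :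
    incl₂ hE D F ≫ incl₂ hE B (D ⊗ F) ≫ (α_ B D F).inv = incl₂ hE (B ⊗ D) F := by
  rw [incl₂_comp_associator_inv, ← tensorHom_id, incl₂_comp_tensorHom, Category.id_comp]

theorem incl₁_comp_incl₂ (B D F : C) :
    incl₁ hE D F ≫ incl₂ hE B (D ⊗ F) ≫ (α_ B D F).inv =
      incl₂ hE B D ≫ incl₁ hE (B ⊗ D) F := by
  rw [incl₂_comp_associator_inv, ← tensorHom_id, incl₁_comp_tensorHom]

end Inclusions

/-! ### Full comonoidal systems -/

namespace ComonoidalSystem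

section Full

variable {S : Type w} [AddMonoid S] {C : Type u} [Category.{v} C] [MonoidalCategory C]
  (hE : IsInitial (𝟙_ C)) {𝒜 : S → C} (Y : ComonoidalSystem 𝒜) (hY : Y.IsFull)

theorem comulOf_comp_mul {s t u : S} (h : s + t = u) : Y.comulOf h ≫ Y.mul hY h = 𝟙 _ := by
  have := hY.isIso_comul s t
  subst h
  simp [comulOf, mul]

theorem mul_comp_comulOf {s t u : S} (h : s + t = u) : Y.mul hY h ≫ Y.comulOf h = 𝟙 _ := by
  have := hY.isIso_comul s t
  subst h
  simp [comulOf, mul]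

/-- Associativity of the inverse coproducts. -/
theorem mul_assoc {r s t a b u : S} (hrs : r + s = a) (hat : a + t = u) (hst : s + t = b)
    (hrb : r + b = u) :
    (α_ _ _ _).inv ≫ Y.mul hY hrs ▷ 𝒜 t ≫ Y.mul hY hat =
      𝒜 r ◁ Y.mul hY hst ≫ Y.mul hY hrb := by
  have h := Y.comulOf_assoc hrs hat hst hrb
  calc (α_ _ _ _).inv ≫ Y.mul hY hrs ▷ 𝒜 t ≫ Y.mul hY hat
      = (α_ _ _ _).inv ≫ Y.mul hY hrs ▷ 𝒜 t ≫ Y.mul hY hat ≫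
          (Y.comulOf hrb ≫ 𝒜 r ◁ Y.comulOf hst) ≫ 𝒜 r ◁ Y.mul hY hst ≫ Y.mul hY hrb := by
        simp [← whiskerLeft_comp_assoc, comulOf_comp_mul]
    _ = 𝒜 r ◁ Y.mul hY hst ≫ Y.mul hY hrb := by
        rw [← h]
        simp [reassoc_of% @Y.mul_comp_comulOf, ← comp_whiskerRight_assoc,
          mul_comp_comulOf]

/-- The transition morphism `𝒜_s ⟶ 𝒜_s ⊗ 𝒜_p ⟶ 𝒜_t` for `s + p = t`, with an explicit difference
`p` instead of the chosen one of `stage`. -/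
noncomputable def stageOf {s p t : S} (h : s + p = t) : 𝒜 s ⟶ 𝒜 t :=
  incl₁ hE (𝒜 s) (𝒜 p) ≫ Y.mul hY h

/-- Since the unit object is initial and `𝒜_0` is isomorphic to it, the inclusion
`𝒜_s ⟶ 𝒜_s ⊗ 𝒜_0` is inverse to the right counit isomorphism, hence equal to the coproduct. -/
theorem stageOf_add_zero (s : S) : Y.stageOf hE hY (add_zero s) = 𝟙 _ := by
  have h := Y.comulOf_counit_right (add_zero s)
  have h' : incl₁ hE (𝒜 s) (𝒜 0) ≫ 𝒜 s ◁ Y.counit ≫ (ρ_ (𝒜 s)).hom = 𝟙 _ := by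
    have e : hE.to (𝒜 0) ≫ Y.counit = 𝟙 _ := hE.hom_ext _ _
    rw [incl₁, Category.assoc, ← whiskerLeft_comp_assoc, e]
    simp
  have := hY.isIso_counit
  have e : incl₁ hE (𝒜 s) (𝒜 0) = Y.comulOf (add_zero s) := by
    rw [← cancel_mono (𝒜 s ◁ Y.counit ≫ (ρ_ (𝒜 s)).hom), h', h, eqToHom_refl]
  rw [stageOf, e, comulOf_comp_mul]

theorem stageOf_comp_stageOf {s p t q u : S} (h : s + p = t) (h' : t + q = u) :
    Y.stageOf hE hY h ≫ Y.stageOf hE hY h' =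
      Y.stageOf hE hY (show s + (p + q) = u by rw [← add_assoc, h, h']) := by
  have e : incl₁ hE (𝒜 s) (𝒜 p ⊗ 𝒜 q) ≫ 𝒜 s ◁ Y.mul hY (rfl : p + q = p + q) =
      incl₁ hE (𝒜 s) (𝒜 (p + q)) := by
    rw [← id_tensorHom, incl₁_comp_tensorHom, Category.id_comp]
  rw [stageOf, stageOf, stageOf, ← e, ← incl₁_comp_incl₁]
  simp only [Category.assoc]
  rw [← Y.mul_assoc hY h h' rfl, Iso.hom_inv_id_assoc]
  rw [← tensorHom_id, reassoc_of% @incl₁_comp_tensorHom]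

/-- The second inclusion `𝒜_p ⟶ 𝒜_s ⊗ 𝒜_p ⟶ 𝒜_t` for `s + p = t`. -/
noncomputable def shift {s p t : S} (h : s + p = t) : 𝒜 p ⟶ 𝒜 t :=
  incl₂ hE (𝒜 s) (𝒜 p) ≫ Y.mul hY h

/-- Shifts compose: both sides place the increment `x` of `𝒜_x` after `s = r + a`. -/
theorem shift_comp_shift {r a s x q u : S} (hs : r + a = s) (hx : s + x = u) (hq : a + x = q)
    (hu : r + q = u) : Y.shift hE hY hq ≫ Y.shift hE hY hu = Y.shift hE hY hx := by
  have e : Y.mul hY hq ≫ incl₂ hE (𝒜 r) (𝒜 q) =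
      incl₂ hE (𝒜 r) (𝒜 a ⊗ 𝒜 x) ≫ 𝒜 r ◁ Y.mul hY hq := by
    rw [← id_tensorHom, incl₂_comp_tensorHom]
  rw [shift, shift, shift, Category.assoc, reassoc_of% e, ← Y.mul_assoc hY hs hx,
    reassoc_of% @incl₂_comp_incl₂, ← tensorHom_id,
    reassoc_of% @incl₂_comp_tensorHom, Category.id_comp]

/-- Restricting the shift of `𝒜_{p+q}` to the first part `𝒜_p` gives the shift of `𝒜_p`, followed by
a transition morphism. -/
theorem stageOf_comp_shift {s p t q y u : S} (ht : s + p = t) (hu : t + q = u) (hy : p + q = y)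
    (hsy : s + y = u) : Y.stageOf hE hY hy ≫ Y.shift hE hY hsy =
      Y.shift hE hY ht ≫ Y.stageOf hE hY hu := by
  have e : Y.mul hY hy ≫ incl₂ hE (𝒜 s) (𝒜 y) =
      incl₂ hE (𝒜 s) (𝒜 p ⊗ 𝒜 q) ≫ 𝒜 s ◁ Y.mul hY hy := by
    rw [← id_tensorHom, incl₂_comp_tensorHom]
  rw [stageOf, stageOf, shift, shift, Category.assoc, reassoc_of% e, ← Y.mul_assoc hY ht hu,
    reassoc_of% @incl₁_comp_incl₂, ← tensorHom_id,
    reassoc_of% @incl₁_comp_tensorHom, Category.assoc]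

end Full

section Stage

variable {S : Type w} [AddCancelMonoid S] [LinearOrder S] [LeftDivisibilityOrder S]
  {C : Type u} [Category.{v} C] [MonoidalCategory C]
  (hE : IsInitial (𝟙_ C)) {𝒜 : S → C} (Y : ComonoidalSystem 𝒜) (hY : Y.IsFull)

theorem le_of_add_eq {s p t : S} (h : s + p = t) : s ≤ t :=
  (LeftDivisibilityOrder.le_iff s t).2 ⟨p, h⟩

theorem stage_eq {s p t : S} (hst : s ≤ t) (h : s + p = t) :
    Y.stage hE hY hst = Y.stageOf hE hY h := by
  obtain rfl : ((LeftDivisibilityOrder.le_iff s t).1 hst).choose = p :=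
    add_left_cancel (((LeftDivisibilityOrder.le_iff s t).1 hst).choose_spec.trans h.symm)
  rfl

theorem isInductiveSystem_stage : IsInductiveSystem 𝒜 (fun h => Y.stage hE hY h) where
  directed := exists_ge_ge
  map_id s := by rw [Y.stage_eq hE hY le_rfl (add_zero s), stageOf_add_zero]
  map_comp {a b c} hab hbc := by
    obtain ⟨p, rfl⟩ := (LeftDivisibilityOrder.le_iff a b).1 hab
    obtain ⟨q, rfl⟩ := (LeftDivisibilityOrder.le_iff _ c).1 hbc
    rw [Y.stage_eq hE hY hab rfl, Y.stage_eq hE hY hbc rfl, stageOf_comp_stageOf,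
      Y.stage_eq hE hY (hab.trans hbc)]

end Stage

/-! ### The Lévy process -/

section Levy

variable {S : Type w} [AddCancelMonoid S] [LinearOrder S] [LeftDivisibilityOrder S]
  {C : Type u} [Category.{v} C] [MonoidalCategory C]
  (hE : IsInitial (𝟙_ C)) {𝒜 : S → C} (Y : ComonoidalSystem 𝒜) (hY : Y.IsFull)
  {B : C} {i : ∀ t, 𝒜 t ⟶ B}

/-- Consecutive increments are independent. The intervals `[s₀, t₀], [s₁, t₁], …` all lie in some
`[r, u]`, and the independence morphism is constructed with values in `𝒜_{u-r}` by induction: for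
the first interval `[s₀, t₀]` and a morphism for the others with values in `𝒜_{u-t₀}`, multiply
to get values in `𝒜_{u-s₀}`, and shift from there to `𝒜_{u-r}`. -/
theorem exists_independence
    (hi : ∀ {s p t : S} (h : s + p = t), Y.stageOf hE hY h ≫ i t = i s) {A : S → C}
    (f : ∀ t, A t ⟶ 𝒜 t) :
    ∀ (n : ℕ) (r : S) (s t p : Fin n → S) (h : ∀ k, s k + p k = t k)
      (_ : ∀ (k : ℕ) (hk : k + 1 < n), t ⟨k, by omega⟩ ≤ s ⟨k + 1, hk⟩)
      (_ : ∀ hn : 0 < n, r ≤ s ⟨0, hn⟩),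
      ∃ (q u : S) (hq : r + q = u) (g : tensorFin (fun k => A (p k)) ⟶ 𝒜 q),
        ∀ k, inclFin hE (fun k => A (p k)) k ≫ g ≫ Y.shift hE hY hq ≫ i u =
          f (p k) ≫ Y.shift hE hY (h k) ≫ i (t k)
  | 0, r, _, _, _, _, _, _ => ⟨0, r, add_zero r, hE.to _, fun k => k.elim0⟩
  | n + 1, r, s, t, p, h, hst, hr => by
    obtain ⟨q, u, hq, g, hg⟩ := exists_independence hi f n (t 0) (fun k => s k.succ)
      (fun k => t k.succ) (fun k => p k.succ) (fun k => h k.succ)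
      (fun k hk => hst (k + 1) (by omega)) (fun hn => hst 0 (by omega))
    obtain ⟨a, ha⟩ := (LeftDivisibilityOrder.le_iff r (s 0)).1 (hr (by omega))
    have hs : s 0 + (p 0 + q) = u := by rw [← add_assoc, h 0, hq]
    have hu : r + (a + (p 0 + q)) = u := by rw [← add_assoc, ha, hs]
    refine ⟨a + (p 0 + q), u, hu, (f (p 0) ⊗ₘ g) ≫ Y.mul hY rfl ≫ Y.shift hE hY rfl, fun k => ?_⟩
    have e : ((f (p 0) ⊗ₘ g) ≫ Y.mul hY rfl ≫ Y.shift hE hY rfl) ≫ Y.shift hE hY hu ≫ i u =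
        (f (p 0) ⊗ₘ g) ≫ Y.mul hY rfl ≫ Y.shift hE hY hs ≫ i u := by
      rw [← Y.shift_comp_shift hE hY ha hs rfl hu]
      simp only [Category.assoc]
    refine (congrArg (inclFin hE (fun k => A (p k)) k ≫ ·) e).trans ?_
    revert k
    refine Fin.cases ?_ fun k => ?_
    · change incl₁ hE (A (p 0)) _ ≫ _ = _
      rw [reassoc_of% @incl₁_comp_tensorHom]
      have e₁ := Y.stageOf_comp_shift hE hY (h 0) hq rfl hs
      rw [stageOf, Category.assoc] at e₁
      rw [reassoc_of% e₁, hi]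
    · change (inclFin hE (fun k => A (p k.succ)) k ≫ incl₂ hE (A (p 0)) _) ≫ _ = _
      rw [Category.assoc, reassoc_of% @incl₂_comp_tensorHom]
      have e₂ := Y.shift_comp_shift hE hY (h 0) hq rfl hs
      rw [shift, Category.assoc] at e₂
      rw [reassoc_of% e₂, hg]

end Levy

end ComonoidalSystem

/-- A cocone `i` on the objects `𝒜_t` turns the morphisms `A_t ⟶ 𝒜_t` into a Lévy process. The
independence morphism of two adjacent increments is the multiplication `𝒜_p ⊗ 𝒜_q ⟶ 𝒜_{p+q}`, and
it recovers the increment over `p + q` because the `A_t ⟶ 𝒜_t` respect the coproducts. -/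
theorem IsLimitFamily.isLevyProcess {S : Type w} [AddCancelMonoid S] [LinearOrder S]
    [LeftDivisibilityOrder S] {C : Type u} [Category.{v} C] [MonoidalCategory C]
    (hE : IsInitial (𝟙_ C)) {A 𝒜 : S → C} {X : ComonoidalSystem A}
    {D : ∀ (t : S) (τ : Factorization t), tensorWord A τ.word ⟶ 𝒜 t} (hD : IsLimitFamily X D)
    {Y : ComonoidalSystem 𝒜} (hY : Y.IsFull) (hYD : Y.IsGenerated D)
    {B : C} {i : ∀ t, 𝒜 t ⟶ B} (hi : ∀ {s t : S} (h : s ≤ t), Y.stage hE hY h ≫ i t = i s) :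
    IsLevyProcess hE X (fun h => levyMorphism hE X D Y hY i h) := by
  have hi' : ∀ {s p t : S} (h : s + p = t), Y.stageOf hE hY h ≫ i t = i s := fun h => by
    rw [← Y.stage_eq hE hY (ComonoidalSystem.le_of_add_eq h) h, hi]
  have hj : ∀ {s p t : S} (h : s + p = t), levyMorphism hE X D Y hY i h =
      X.toLimit D p ≫ Y.shift hE hY h ≫ i t := fun h => by
    simp [levyMorphism, ComonoidalSystem.shift]
  refine ⟨fun t => ?_, fun n s t p h hst => ?_, fun {r s t p q} hp hq => ?_⟩
  · rw [hj, ComonoidalSystem.toLimit, dif_pos rfl, eqToHom_refl, Category.id_comp]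
    exact (Category.assoc _ _ _).trans (congrArg (X.counit ≫ ·) (hE.hom_ext _ _))
  · obtain ⟨q, u, hq, g, hg⟩ := Y.exists_independence hE hY hi' (X.toLimit D) n 0 s t p h hst
      fun hn => ComonoidalSystem.le_of_add_eq (zero_add _)
    exact ⟨g ≫ Y.shift hE hY hq ≫ i u, fun k => (hg k).trans (hj (h k)).symm⟩
  · have ht : r + (p + q) = t := by rw [← add_assoc, hp, hq]
    refine ⟨(X.toLimit D p ⊗ₘ X.toLimit D q) ≫ Y.mul hY rfl ≫ Y.shift hE hY ht ≫ i t,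
      ⟨?_, ?_⟩, ?_⟩
    · have e := Y.stageOf_comp_shift hE hY hp hq rfl ht
      rw [ComonoidalSystem.stageOf, Category.assoc] at e
      rw [reassoc_of% @incl₁_comp_tensorHom, reassoc_of% e, hi', hj]
    · have e := Y.shift_comp_shift hE hY hp hq rfl ht
      rw [ComonoidalSystem.shift, Category.assoc] at e
      rw [reassoc_of% @incl₂_comp_tensorHom, reassoc_of% e, hj]
    · have e : Y.comul p q ≫ Y.mul hY rfl = 𝟙 _ := by
        simpa [ComonoidalSystem.comulOf] using Y.comulOf_comp_mul hY (rfl : p + q = p + q)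
      rw [← reassoc_of% (hD.toLimit_comp_comul hYD p q), reassoc_of% e, hj]

end CatLevy

theorem theorem4p18 {S : Type w} [AddCancelMonoid S] [LinearOrder S]
    [CatLevy.LeftDivisibilityOrder S]
    {C : Type u} [Category.{v} C] [MonoidalCategory C]
    (hE : IsInitial (𝟙_ C))
    (hC : CatLevy.InductivelyComplete.{w} C)
    (hT : CatLevy.PreservesInductiveLimits.{w} (MonoidalCategory.tensor C))
    {A : S → C} (X : CatLevy.ComonoidalSystem A) :
    -- the objects `A_τ`, `τ` a factorization of `t`, form an inductive system with a limit
    ∃ hX : ∀ t : S, CatLevy.IsInductiveSystem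
        (fun τ : CatLevy.Factorization t => CatLevy.tensorWord A τ.word) (fun h => X.refine h),
      (∀ t : S, Nonempty (ColimitCocone (hX t).functor)) ∧
      -- for every choice of these limits `𝒜_t`, with canonical morphisms `D^τ`,
      ∀ L : ∀ t : S, ColimitCocone (hX t).functor,
        let 𝒜 : S → C := fun t => (L t).cocone.pt
        let D : ∀ (t : S) (τ : CatLevy.Factorization t), CatLevy.tensorWord A τ.word ⟶ 𝒜 t :=
          fun t τ => (L t).cocone.ι.app τ
        -- there is a unique generated comonoidal system `Y` on the objects `𝒜_t`, it is full,
        ∃ Y : CatLevy.ComonoidalSystem 𝒜,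
          (Y.IsGenerated D ∧ ∀ Y' : CatLevy.ComonoidalSystem 𝒜, Y'.IsGenerated D → Y' = Y) ∧
          ∃ hY : Y.IsFull,
            -- the objects `𝒜_t` form an inductive system with a limit,
            ∃ hI : CatLevy.IsInductiveSystem 𝒜 (fun h => Y.stage hE hY h),
              Nonempty (ColimitCocone hI.functor) ∧
              -- and for every choice of the limit the `j_{s,t}` form a Lévy process
              ∀ M : ColimitCocone hI.functor,
                CatLevy.IsLevyProcess hE X
                  (fun h => CatLevy.levyMorphism hE X D Y hY (fun t => M.cocone.ι.app t) h) := by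
  refine ⟨X.isInductiveSystem_refine, fun t => ?_, fun L => ?_⟩
  · have := hC (CatLevy.Factorization t)
    exact ⟨getColimitCocone _⟩
  · have hD := X.isLimitFamily hT L
    obtain ⟨Y, hY, hF⟩ := hD.exists_isGenerated
    refine ⟨Y, ⟨hY, fun Y' hY' => hD.eq_of_isGenerated hY' hY⟩, hF,
      Y.isInductiveSystem_stage hE hF, ?_, fun M => ?_⟩
    · have := hC S
      exact ⟨getColimitCocone _⟩
    · exact hD.isLevyProcess hE hF hY fun h => M.cocone.w (homOfLE h)
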